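/- Write $\mathbb{D}=\{z\in\mathbb{C}:|z|<1\}$. For a finite non-negative measure $d\mu$ on the unit circle (a power spectrum) and $a\in\mathbb{D}$ put $$H[d\mu](a)=\frac1{2\pi}\int_{-\pi}^{\pi}\frac{e^{i\theta}+a}{e^{i\theta}-a}\,d\mu(\theta),\qquad P[d\mu](a)=\frac1{2\pi}\int_{-\pi}^{\pi}\frac{1-|a|^2}{|e^{i\theta}-a|^2}\,d\mu(\theta).$$ Let $n\ge 0$, let $z_0,\dots,z_n\in\mathbb{D}$ with $z_0=0$ and let $w_0,\dots,w_n\in\mathbb{C}$ with $w_0$ real be such that the Pick matrix $$\left[\frac{w_k+\overline{w_\ell}}{1-z_k\overline{z_\ell}}\right]_{k,\ell=0}^n$$ is positive definite. Let $$\mathcal{F}_{\mathbf z,\mathbf w}=\{d\mu\ge 0:\ H[d\mu](z_k)=w_k,\ k=0,\dots,n\};$$ equivalently, $d\mu\in\mathcal{F}_{\mathbf z,\mathbf w}$ if and only if the covariances $\frac1{2\pi}\int_{-\pi}^{\pi} G_k(e^{i\theta})\overline{G_\ell(e^{i\theta})}\,d\mu(\theta)$ of the outputs of the filter bank $G_k(z)=z/(z-z_k)$,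 $k=0,\dots,n$, driven by a process with power spectrum $d\mu$, are one half of the entries of the Pick matrix. Let $K\subset\mathbb{D}$ be non-empty and closed in $\mathbb{C}$, and let $$\delta_K(d\mu_0,d\mu_1)=\max_{a\in K}\bigl|P[d\mu_0](a)-P[d\mu_1](a)\bigr|,\qquad \rho_{\delta_K}(\mathcal{F}_{\mathbf z,\mathbf w})=\sup\{\delta_K(d\mu_0,d\mu_1):d\mu_0,d\mu_1\in\mathcal{F}_{\mathbf z,\mathbf w}\},\qquad B_{\mathbf z}(a)=\prod_{k=0}^n\frac{a-z_k}{1-\overline{z_k}\,a}.$$ Then the maximum below is attained and $$\rho_{\delta_K}(\mathcal{F}_{\mathbf z,\mathbf w})\le\max_{a\in K}\frac{4w_0|B_{\mathbf z}(a)|}{1-|a|^2}.$$ Further, if $K\not\subset\{z_0,\dots,z_n\}$ (for instance, if $K$ is infinite), then equality holds if and only if there is an $\alpha\in K$ that maximizes $|B_{\mathbf z}(a)|/(1-|a|^2)$ over $a\in K$ and satisfies $$w_k=w_0\,\frac{1+z_k\bar\alpha}{1-z_k\bar\alpha}\qquad\text{for } k=1,\dots,n.$$ -/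

import Mathlib

open MeasureTheory
open scoped ENNReal ComplexOrder ComplexConjugate

/-- The unit circle carries its Borel σ-algebra. -/
noncomputable instance Circle.borelMeasurableSpace : MeasurableSpace Circle := borel Circle

instance Circle.isBorelSpace : BorelSpace Circle := ⟨rfl⟩

/-- The Herglotz transform `H[dμ](a) = (1/2π) ∫ (e^{iθ} + a) / (e^{iθ} - a) dμ(θ)` of a power
spectrum, that is, of a finite non-negative measure on the unit circle. -/
noncomputable def herglotzTransform (μ : FiniteMeasure Circle) (a : ℂ) : ℂ :=
  (1 / (2 * Real.pi) : ℂ) * ∫ ζ : Circle, ((ζ : ℂ) + a) / ((ζ : ℂ) - a) ∂(μ : Measure Circle)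

/-- The Poisson integral `P[dμ](a) = (1/2π) ∫ (1 - |a|²) / |e^{iθ} - a|² dμ(θ)`. -/
noncomputable def poissonIntegral (μ : FiniteMeasure Circle) (a : ℂ) : ℝ :=
  1 / (2 * Real.pi) *
    ∫ ζ : Circle, (1 - ‖a‖ ^ 2) / ‖(ζ : ℂ) - a‖ ^ 2 ∂(μ : Measure Circle)

/-- The distance `δ_K(dμ₀, dμ₁) = sup_{a ∈ K} |P[dμ₀ - dμ₁](a)|`, taken in `[0, ∞]`. -/
noncomputable def deltaK (K : Set ℂ) (μ₀ μ₁ : FiniteMeasure Circle) : ℝ≥0∞ :=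
  ⨆ a ∈ K, ENNReal.ofReal |poissonIntegral μ₀ a - poissonIntegral μ₁ a|

/-- The diameter `ρ_{δ_K}(F)` of a set `F` of power spectra, taken in `[0, ∞]`. -/
noncomputable def diameterK (K : Set ℂ) (F : Set (FiniteMeasure Circle)) : ℝ≥0∞ :=
  ⨆ μ₀ ∈ F, ⨆ μ₁ ∈ F, deltaK K μ₀ μ₁

/-- The Pick matrix `[(w_k + conj w_l) / (1 - z_k conj z_l)]`. -/
noncomputable def pickMatrix {n : ℕ} (z w : Fin (n + 1) → ℂ) :
    Matrix (Fin (n + 1)) (Fin (n + 1)) ℂ :=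
  Matrix.of fun k l => (w k + conj (w l)) / (1 - z k * conj (z l))

/-- The uncertainty set `F_{z,w}`: the power spectra consistent with the data `w` of the filter
bank with poles `z`. `mem_uncertaintySet_iff` expresses it through the output covariances. -/
def uncertaintySet {n : ℕ} (z w : Fin (n + 1) → ℂ) : Set (FiniteMeasure Circle) :=
  {μ | ∀ k, herglotzTransform μ (z k) = w k}

/-- The finite Blaschke product `B_z(a) = ∏_k (a - z_k) / (1 - conj z_k a)`. -/
noncomputable def blaschkeProduct {n : ℕ} (z : Fin (n + 1) → ℂ) (a : ℂ) : ℂ :=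
  ∏ k, (a - z k) / (1 - conj (z k) * a)

/-- The cross-covariance `E{u conj v} = (1/2π) ∫ G_p(e^{iθ}) conj G_q(e^{iθ}) dμ(θ)` of the outputs
of the filters `G_p(z) = z / (z - p)` and `G_q(z) = z / (z - q)` driven by a process with power
spectrum `dμ`. -/
noncomputable def outputCovariance (μ : FiniteMeasure Circle) (p q : ℂ) : ℂ :=
  (1 / (2 * Real.pi) : ℂ) *
    ∫ ζ : Circle, ((ζ : ℂ) / ((ζ : ℂ) - p)) * conj ((ζ : ℂ) / ((ζ : ℂ) - q)) ∂(μ : Measure Circle)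

lemma circle_sub_ne_zero {a : ℂ} (ha : ‖a‖ < 1) (ζ : Circle) : (ζ : ℂ) - a ≠ 0 := by
  intro h
  have := congrArg norm (sub_eq_zero.mp h)
  rw [Circle.norm_coe] at this
  linarith

lemma two_mul_outputCovariance (μ : FiniteMeasure Circle) {p q : ℂ} (hp : ‖p‖ < 1)
    (hq : ‖q‖ < 1) :
    2 * outputCovariance μ p q =
      (herglotzTransform μ p + conj (herglotzTransform μ q)) / (1 - p * conj q) := by
  have hint : ∀ a : ℂ, ‖a‖ < 1 → Integrable (fun ζ : Circle => ((ζ : ℂ) + a) / ((ζ : ℂ) - a))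
      (μ : Measure Circle) := by
    intro a ha
    have hc : Continuous (fun ζ : Circle => ((ζ : ℂ) + a) / ((ζ : ℂ) - a)) :=
      (by fun_prop : Continuous (fun ζ : Circle => (ζ : ℂ) + a)).div
        (by fun_prop) (circle_sub_ne_zero ha)
    exact hc.integrable_of_hasCompactSupport (HasCompactSupport.of_compactSpace _)
  have hpq : 1 - p * conj q ≠ 0 := by
    intro h
    have h1 : ‖p * conj q‖ = 1 := by rw [← sub_eq_zero.mp h]; simp
    rw [norm_mul, RCLike.norm_conj] at h1
    nlinarith [norm_nonneg p, norm_nonneg q]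
  rw [eq_div_iff hpq, outputCovariance, herglotzTransform, herglotzTransform, map_mul,
    ← integral_conj]
  have e1 : conj (1 / (2 * Real.pi) : ℂ) = 1 / (2 * Real.pi) := by
    simp [Complex.conj_ofNat]
  have hq' : Integrable (fun ζ : Circle => conj (((ζ : ℂ) + q) / ((ζ : ℂ) - q)))
      (μ : Measure Circle) := (Complex.conjCLE.integrable_comp_iff).mpr (hint q hq)
  rw [e1, ← mul_add, ← integral_add (hint p hp) hq']
  have e2 : ∀ ζ : Circle, ((ζ : ℂ) + p) / ((ζ : ℂ) - p) + conj (((ζ : ℂ) + q) / ((ζ : ℂ) - q)) =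
      (2 * (1 - p * conj q)) * (((ζ : ℂ) / ((ζ : ℂ) - p)) * conj ((ζ : ℂ) / ((ζ : ℂ) - q))) := by
    intro ζ
    have h1 := circle_sub_ne_zero hp ζ
    have h2 : conj (ζ : ℂ) - conj q ≠ 0 := by
      rw [← map_sub]; exact (map_ne_zero _).mpr (circle_sub_ne_zero hq ζ)
    have h3 : (ζ : ℂ) * conj (ζ : ℂ) = 1 := by
      rw [Complex.mul_conj, Complex.normSq_eq_norm_sq, Circle.norm_coe]; norm_num
    simp only [map_div₀, map_add, map_sub]
    field_simp
    linear_combination (2 * p * conj q) * h3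
  simp only [e2]
  rw [integral_const_mul]
  ring

/-- A power spectrum is consistent with the data `w` if and only if the covariance matrix of the
filter-bank outputs is one half of the Pick matrix. -/
theorem mem_uncertaintySet_iff {n : ℕ} (z w : Fin (n + 1) → ℂ) (hz : ∀ k, ‖z k‖ < 1)
    (hz0 : z 0 = 0) (hw0 : (w 0).im = 0) (μ : FiniteMeasure Circle) :
    μ ∈ uncertaintySet z w ↔
      ∀ k l, 2 * outputCovariance μ (z k) (z l) = pickMatrix z w k l := by
  have h0 : conj (herglotzTransform μ 0) = herglotzTransform μ 0 := by
    have e : ∀ ζ : Circle, ((ζ : ℂ) + 0) / ((ζ : ℂ) - 0) = 1 := fun ζ => by simp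
    simp only [herglotzTransform, e]
    simp [Complex.conj_ofNat]
  have hw : conj (w 0) = w 0 := Complex.conj_eq_iff_im.mpr hw0
  constructor
  · intro h k l
    rw [two_mul_outputCovariance μ (hz k) (hz l), h k, h l]
    rfl
  · intro h
    have h' : ∀ k, herglotzTransform μ (z k) + herglotzTransform μ 0 = w k + w 0 := by
      intro k
      have := h k 0
      rw [two_mul_outputCovariance μ (hz k) (hz 0)] at this
      simpa [pickMatrix, hz0, h0, hw] using this
    have h00 : herglotzTransform μ 0 = w 0 := by
      have := h' 0
      rw [hz0] at this
      linear_combination this / 2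
    intro k
    linear_combination h' k - h00

/-! Upper bound: let `T` be the reciprocal of the Blaschke product with zeros `a, z₁, …, z_n`. It is
unimodular on the circle, and because `z 0 = 0` it is a combination of the Cauchy kernels `ζ / (ζ -
p)` for `p = a` and `p = z k`. The data fix the integrals of the kernels at the nodes, so between
two consistent spectra `∫ T` changes only through the kernel at `a`, whose coefficient is `(1 -
|a|²) / B(a)`. Each integral is at most the mass `2π w₀` in modulus; this is
`abs_poissonIntegral_sub_le`.

Necessity: near equality forces a rotation of `T` to be close to `1` in `μ₀`-mean and to `-1` in
`μ₁`-mean. A factor `ζ - a` removes the pole of `T` at `a`, so for `χ = (ζ - a) / (1 - conj z_j ζ)`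
the integral of `χ T` is the same for both spectra, whence `∫ χ dμ₀ + ∫ χ dμ₁` is nearly `0`. The
data determine this sum, and its vanishing is the stated formula for `w_j`. The estimate is
quantitative (`norm_defect_le`) because the supremum need not be known to be attained; compactness
of `K` then gives `α` (`exists_extremal_of_le_diameterK`).

Sufficiency: for such data a Schur-type parametrization produces consistent spectra whose Herglotz
transforms at `α` fill a disc of radius `2 w₀ |B(α)| / (1 - |α|²)`, and opposite points of it give
the bound (`ofReal_le_diameterK`). -/

/-! ### Disc inequalities and the Cauchy transform. -/

lemma Circle.integrable_of_continuous {E : Type*} [NormedAddCommGroup E]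
    (μ : FiniteMeasure Circle) {f : Circle → E} (hf : Continuous f) :
    Integrable f (μ : Measure Circle) :=
  hf.integrable_of_hasCompactSupport (HasCompactSupport.of_compactSpace _)

lemma one_sub_conj_mul_ne_zero {a b : ℂ} (ha : ‖a‖ < 1) (hb : ‖b‖ ≤ 1) : 1 - conj a * b ≠ 0 := by
  intro h
  have h1 : ‖conj a * b‖ = 1 := by rw [← sub_eq_zero.mp h]; simp
  rw [norm_mul, RCLike.norm_conj] at h1
  nlinarith [norm_nonneg a, norm_nonneg b]

lemma normSq_one_sub_conj_mul (a b : ℂ) :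
    ‖1 - conj a * b‖ ^ 2 - ‖b - a‖ ^ 2 = (1 - ‖a‖ ^ 2) * (1 - ‖b‖ ^ 2) := by
  simp only [← Complex.normSq_eq_norm_sq, Complex.normSq_apply, Complex.sub_re, Complex.sub_im,
    Complex.mul_re, Complex.mul_im, Complex.conj_re, Complex.conj_im, Complex.one_re,
    Complex.one_im]
  ring

lemma norm_sub_le_norm_one_sub_conj_mul {a b : ℂ} (ha : ‖a‖ ≤ 1) (hb : ‖b‖ ≤ 1) :
    ‖b - a‖ ≤ ‖1 - conj a * b‖ := by
  have h := normSq_one_sub_conj_mul a b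
  have h1 : 0 ≤ (1 - ‖a‖ ^ 2) * (1 - ‖b‖ ^ 2) := by
    apply mul_nonneg <;> nlinarith [norm_nonneg a, norm_nonneg b]
  exact le_of_sq_le_sq (by linarith) (norm_nonneg _)

lemma norm_sub_lt_norm_one_sub_conj_mul {a b : ℂ} (ha : ‖a‖ < 1) (hb : ‖b‖ < 1) :
    ‖b - a‖ < ‖1 - conj a * b‖ := by
  have h := normSq_one_sub_conj_mul a b
  have h1 : 0 < (1 - ‖a‖ ^ 2) * (1 - ‖b‖ ^ 2) := by
    apply mul_pos <;> nlinarith [norm_nonneg a, norm_nonneg b]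
  exact lt_of_pow_lt_pow_left₀ 2 (norm_nonneg _) (by linarith)

lemma Circle.norm_one_sub_conj_mul (a : ℂ) (ζ : Circle) :
    ‖1 - conj a * (ζ : ℂ)‖ = ‖(ζ : ℂ) - a‖ := by
  have h := normSq_one_sub_conj_mul a (ζ : ℂ)
  rw [Circle.norm_coe] at h
  exact (pow_left_inj₀ (norm_nonneg _) (norm_nonneg _) two_ne_zero).mp (by linarith)

lemma Circle.mul_conj_coe (ζ : Circle) : (ζ : ℂ) * conj (ζ : ℂ) = 1 := by
  rw [Complex.mul_conj, Complex.normSq_eq_norm_sq, Circle.norm_coe]; norm_num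

/-- The Cauchy transform `∫ ζ / (ζ - a) dμ(ζ)`. -/
noncomputable def cauchyTransform (μ : FiniteMeasure Circle) (a : ℂ) : ℂ :=
  ∫ ζ : Circle, (ζ : ℂ) / ((ζ : ℂ) - a) ∂(μ : Measure Circle)

lemma continuous_cauchyKernel {a : ℂ} (ha : ‖a‖ < 1) :
    Continuous fun ζ : Circle => (ζ : ℂ) / ((ζ : ℂ) - a) :=
  (by fun_prop : Continuous fun ζ : Circle => (ζ : ℂ)).div (by fun_prop) (circle_sub_ne_zero ha)

lemma continuous_herglotzKernel {a : ℂ} (ha : ‖a‖ < 1) :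
    Continuous fun ζ : Circle => ((ζ : ℂ) + a) / ((ζ : ℂ) - a) :=
  (by fun_prop : Continuous (fun ζ : Circle => (ζ : ℂ) + a)).div
    (by fun_prop) (circle_sub_ne_zero ha)

lemma cauchyTransform_zero (μ : FiniteMeasure Circle) :
    cauchyTransform μ 0 = ((μ : Measure Circle).real Set.univ : ℂ) := by
  simp [cauchyTransform]

lemma two_pi_mul_herglotzTransform (μ : FiniteMeasure Circle) {a : ℂ} (ha : ‖a‖ < 1) :
    2 * Real.pi * herglotzTransform μ a =
      2 * cauchyTransform μ a - ((μ : Measure Circle).real Set.univ : ℂ) := by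
  have e : ∀ ζ : Circle, ((ζ : ℂ) + a) / ((ζ : ℂ) - a) = 2 * ((ζ : ℂ) / ((ζ : ℂ) - a)) - 1 := by
    intro ζ
    have := circle_sub_ne_zero ha ζ
    field_simp
    ring
  have hpi : (Real.pi : ℂ) ≠ 0 := by exact_mod_cast Real.pi_ne_zero
  rw [herglotzTransform]
  simp only [e]
  rw [integral_sub ((Circle.integrable_of_continuous μ (continuous_cauchyKernel ha)).const_mul 2)
    (integrable_const _), integral_const_mul, cauchyTransform]
  simp
  field_simp

lemma poissonIntegral_eq_re (μ : FiniteMeasure Circle) {a : ℂ} (ha : ‖a‖ < 1) :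
    poissonIntegral μ a = (herglotzTransform μ a).re := by
  have e : ∀ ζ : Circle, (1 - ‖a‖ ^ 2) / ‖(ζ : ℂ) - a‖ ^ 2 = (((ζ : ℂ) + a) / ((ζ : ℂ) - a)).re := by
    intro ζ
    have := congrFun (poissonKernel_eq_re_herglotzRieszKernel (c := 0) (w := a)) (ζ : ℂ)
    simpa [poissonKernel_def, herglotzRieszKernel_def, Circle.norm_coe] using this
  have h2 := integral_re (𝕜 := ℂ) (Circle.integrable_of_continuous μ (continuous_herglotzKernel ha))
  simp only [RCLike.re_eq_complex_re] at h2
  rw [poissonIntegral, herglotzTransform]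
  simp only [e, h2]
  rw [show (1 / (2 * Real.pi) : ℂ) = ((1 / (2 * Real.pi) : ℝ) : ℂ) by push_cast; rfl,
    Complex.re_ofReal_mul]

/-! ### Partial fractions in Cauchy kernels. -/

-- This is barycentric Lagrange interpolation divided by the nodal polynomial. The extra factor `x`
-- yields the kernels `x / (x - v i)`, which include the constant `1` when a node is `0`.
open Polynomial in
lemma partialFraction {ι : Type*} [Fintype ι] [DecidableEq ι] {v : ι → ℂ}
    (hv : Function.Injective v) {p : ℂ[X]} (hp : p.degree < Fintype.card ι) {x : ℂ}
    (hx : ∀ i, x - v i ≠ 0) :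
    x * p.eval x / ∏ i, (x - v i) =
      ∑ i, p.eval (v i) / (∏ j ∈ Finset.univ.erase i, (v i - v j)) * (x / (x - v i)) := by
  have h1 := Lagrange.eq_interpolate (s := Finset.univ) (f := p) (v := v) hv.injOn (by simpa using hp)
  have h2 := Lagrange.eval_interpolate_not_at_node (s := Finset.univ) (v := v)
    (fun i => p.eval (v i)) (x := x) (fun i _ => sub_ne_zero.mp (hx i))
  rw [← h1, Lagrange.eval_nodal] at h2
  have h3 : ∏ i, (x - v i) ≠ 0 := Finset.prod_ne_zero_iff.mpr fun i _ => hx i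
  rw [h2, mul_left_comm, mul_div_cancel_left₀ _ h3, Finset.mul_sum]
  refine Finset.sum_congr rfl fun i _ => ?_
  rw [Lagrange.nodalWeight, Finset.prod_inv_distrib]
  ring

open Polynomial in
lemma integral_partialFraction {ι : Type*} [Fintype ι] [DecidableEq ι] {v : ι → ℂ}
    (hv : Function.Injective v) (hv1 : ∀ i, ‖v i‖ < 1) {p : ℂ[X]}
    (hp : p.degree < Fintype.card ι) (μ : FiniteMeasure Circle) :
    ∫ ζ : Circle, (ζ : ℂ) * p.eval (ζ : ℂ) / ∏ i, ((ζ : ℂ) - v i) ∂(μ : Measure Circle) =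
      ∑ i, p.eval (v i) / (∏ j ∈ Finset.univ.erase i, (v i - v j)) * cauchyTransform μ (v i) := by
  simp only [fun ζ : Circle => partialFraction hv hp (fun i => circle_sub_ne_zero (hv1 i) ζ)]
  rw [integral_finsetSum _ fun i _ =>
    (Circle.integrable_of_continuous μ (continuous_cauchyKernel (hv1 i))).const_mul _]
  simp only [integral_const_mul, cauchyTransform]

/-! ### Unimodular functions close to a constant in mean. -/

/-- On the unit circle `|1 - T|² = 2 (1 - Re T)`, so the arithmetic-geometric mean inequality bounds
`|1 - T|` by an expression affine in `Re T`. Integrating it replaces an appeal to Cauchy-Schwarz. -/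
lemma norm_one_sub_le_of_norm_eq_one {T : ℂ} (hT : ‖T‖ = 1) {ε : ℝ} (hε : 0 < ε) :
    ‖1 - T‖ ≤ ε + (1 - T.re) / (2 * ε) := by
  have h : ‖1 - T‖ ^ 2 = 2 * (1 - T.re) := by
    have h1 : T.re * T.re + T.im * T.im = 1 := by
      rw [← Complex.normSq_apply, Complex.normSq_eq_norm_sq, hT]; norm_num
    rw [← Complex.normSq_eq_norm_sq, Complex.normSq_apply]
    simp
    linarith
  have h2 : (1 - T.re) / (2 * ε) = ‖1 - T‖ ^ 2 / (4 * ε) := by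
    rw [h]; field_simp; ring
  rw [h2]
  have : ε + ‖1 - T‖ ^ 2 / (4 * ε) - ‖1 - T‖ = (2 * ε - ‖1 - T‖) ^ 2 / (4 * ε) := by
    field_simp; ring
  have h3 : 0 ≤ (2 * ε - ‖1 - T‖) ^ 2 / (4 * ε) := by positivity
  linarith

/-- A unimodular function that is nearly `1` in `μ`-mean is nearly `1` when integrated against
bounded functions. -/
lemma norm_integral_mul_one_sub_le (μ : FiniteMeasure Circle) {T χ : Circle → ℂ}
    (hT : Continuous T) (hT1 : ∀ ζ, ‖T ζ‖ = 1) {C : ℝ} (hC : ∀ ζ, ‖χ ζ‖ ≤ C)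
    {ε : ℝ} (hε : 0 < ε) :
    ‖∫ ζ, χ ζ * (1 - T ζ) ∂(μ : Measure Circle)‖ ≤
      C * (ε * (μ : Measure Circle).real Set.univ +
        ((μ : Measure Circle).real Set.univ - (∫ ζ, T ζ ∂(μ : Measure Circle)).re) / (2 * ε)) := by
  have hC0 : 0 ≤ C := (norm_nonneg _).trans (hC 1)
  have hi : Integrable (fun ζ => (T ζ).re) (μ : Measure Circle) :=
    Circle.integrable_of_continuous μ (Complex.continuous_re.comp hT)
  have hint : ∫ ζ, C * (ε + (1 - (T ζ).re) / (2 * ε)) ∂(μ : Measure Circle) =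
      C * (ε * (μ : Measure Circle).real Set.univ +
        ((μ : Measure Circle).real Set.univ - (∫ ζ, T ζ ∂(μ : Measure Circle)).re) / (2 * ε)) := by
    have h2 := integral_re (𝕜 := ℂ) (Circle.integrable_of_continuous μ hT)
    simp only [RCLike.re_eq_complex_re] at h2
    have h3 : Integrable (fun ζ => (1 - (T ζ).re) / (2 * ε)) (μ : Measure Circle) :=
      ((integrable_const _).sub hi).div_const _
    rw [integral_const_mul, integral_add (integrable_const _) h3, integral_div,
      integral_sub (integrable_const _) hi, h2]
    simp [mul_comm]
  rw [← hint]
  refine norm_integral_le_of_norm_le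
    (Circle.integrable_of_continuous μ (by fun_prop)) (ae_of_all _ fun ζ => ?_)
  rw [norm_mul]
  exact mul_le_mul (hC ζ) (norm_one_sub_le_of_norm_eq_one (hT1 ζ) hε) (norm_nonneg _) hC0

/-! ### Herglotz representation of functions holomorphic up to the boundary. -/

lemma DifferentiableAt.diffContOnCl_unitBall {f : ℂ → ℂ}
    (hf : ∀ x : ℂ, ‖x‖ ≤ 1 → DifferentiableAt ℂ f x) :
    DiffContOnCl ℂ f (Metric.ball 0 |1|) := by
  refine DifferentiableOn.diffContOnCl fun x hx => (hf x ?_).differentiableWithinAt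
  rw [closure_ball _ (by norm_num)] at hx
  simpa using hx

/-- **Herglotz formula** on the unit circle for a function holomorphic up to the boundary. -/
lemma circleAverage_herglotzKernel_mul_re {f : ℂ → ℂ}
    (hf : ∀ x : ℂ, ‖x‖ ≤ 1 → DifferentiableAt ℂ f x) (hf0 : (f 0).im = 0) {a : ℂ} (ha : ‖a‖ < 1) :
    Real.circleAverage (fun ζ => (ζ + a) / (ζ - a) * ((f ζ).re : ℂ)) 0 1 = f a := by
  have hfd := DifferentiableAt.diffContOnCl_unitBall hf
  have hsub : ∀ ζ ∈ Metric.sphere (0 : ℂ) |1|, ζ - a ≠ 0 := by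
    intro ζ hζ
    simp at hζ
    exact circle_sub_ne_zero ha ⟨ζ, by simpa [Submonoid.unitSphere] using hζ⟩
  -- On the circle the Herglotz kernel is the conjugate of `(1 + conj a ζ) / (1 - conj a ζ)`, which
  -- is holomorphic on the closed disc. Thus kernel times `conj f` is `conj g`, whose average is
  -- `conj (g 0) = conj (f 0)`.
  set g : ℂ → ℂ := fun ζ => (1 + conj a * ζ) / (1 - conj a * ζ) * f ζ with hg
  have hgx : ∀ x : ℂ, ‖x‖ ≤ 1 →
      DifferentiableAt ℂ (fun ζ => (1 + conj a * ζ) / (1 - conj a * ζ)) x := fun x hx =>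
    DifferentiableAt.div (by fun_prop) (by fun_prop) (one_sub_conj_mul_ne_zero ha hx)
  have hgd := DifferentiableAt.diffContOnCl_unitBall (f := g) fun x hx =>
    (hgx x hx).mul (hf x hx)
  have hfc : ContinuousOn f (Metric.sphere 0 |1|) := fun x hx =>
    (hf x (by simp at hx; exact hx.le)).continuousAt.continuousWithinAt
  have hgc : ContinuousOn g (Metric.sphere 0 |1|) := fun x hx => by
    have hx : ‖x‖ = 1 := by simpa using hx
    exact ((hgx x hx.le).mul (hf x hx.le)).continuousAt.continuousWithinAt
  have hci : ∀ h : ℂ → ℂ, ContinuousOn h (Metric.sphere 0 |1|) → CircleIntegrable h 0 1 :=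
    fun h hh => hh.circleIntegrable'
  have h1 := hfd.circleAverage_smul_div (w := a) (by simpa using ha)
  have h2 := hfd.circleAverage
  have h3 := hgd.circleAverage
  have h4 := (Complex.conjCLE : ℂ →L[ℝ] ℂ).circleAverage_comp_comm (hci g hgc)
  have hKc : ContinuousOn (fun ζ => ((ζ - 0) / (ζ - a)) • f ζ) (Metric.sphere 0 |1|) := by
    refine ContinuousOn.smul (ContinuousOn.div (by fun_prop) (by fun_prop) hsub) hfc
  have hcg : ContinuousOn (fun ζ => conj (g ζ)) (Metric.sphere 0 |1|) :=
    Complex.continuous_conj.comp_continuousOn hgc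
  -- Half the kernel is `ζ / (ζ - a) - 1/2`. The three averages are `f a`, `-f 0 / 2` and `conj (f
  -- 0) / 2`, and the last two cancel as `f 0` is real.
  have h5 : Real.circleAverage (fun ζ => (ζ + a) / (ζ - a) * ((f ζ).re : ℂ)) 0 1 =
      Real.circleAverage ((fun ζ => ((ζ - 0) / (ζ - a)) • f ζ) +
        (fun ζ => (-1 / 2 : ℂ) • f ζ) + (fun ζ => (1 / 2 : ℂ) • conj (g ζ))) 0 1 := by
    refine Real.circleAverage_congr_sphere fun ζ hζ => ?_
    have hs := hsub ζ hζ
    have hn : ‖ζ‖ = 1 := by simpa using hζ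
    have hz : ζ * conj ζ = 1 := by
      rw [Complex.mul_conj, Complex.normSq_eq_norm_sq, hn]; norm_num
    have hd : 1 - a * conj ζ ≠ 0 := by
      have := (map_ne_zero (starRingEnd ℂ)).mpr (one_sub_conj_mul_ne_zero ha hn.le)
      simpa using this
    have hK : (1 + a * conj ζ) / (1 - a * conj ζ) = (ζ + a) / (ζ - a) := by
      rw [div_eq_div_iff hd hs]
      linear_combination (2 * a) * hz
    have hre : ((f ζ).re : ℂ) = (f ζ + conj (f ζ)) / 2 := by
      rw [Complex.add_conj]; push_cast; ring
    simp only [Pi.add_apply, hg, map_mul, map_div₀, map_add, map_sub, map_one, Complex.conj_conj,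
      hK, hre, smul_eq_mul]
    field_simp
    ring
  rw [h5, Real.circleAverage_add, Real.circleAverage_add, h1, Real.circleAverage_fun_smul,
    Real.circleAverage_fun_smul, h2]
  · have h6 : Real.circleAverage (fun ζ => conj (g ζ)) 0 1 = conj (f 0) := by
      have : (Complex.conjCLE : ℂ →L[ℝ] ℂ) ∘ g = fun ζ => conj (g ζ) := rfl
      rw [← this, h4, h3]
      simp [hg]
    rw [h6, Complex.conj_eq_iff_im.mpr hf0]
    simp only [smul_eq_mul]
    ring
  · exact hci _ hKc
  · exact hci _ (hfc.fun_const_smul _)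
  · exact hci _ (hKc.add (hfc.fun_const_smul _))
  · exact hci _ (hcg.fun_const_smul _)

/-- A function holomorphic up to the boundary of the disc, of non-negative real part on the
circle and real at the origin, is the Herglotz transform of a power spectrum. -/
theorem exists_herglotzTransform_eq {f : ℂ → ℂ}
    (hf : ∀ x : ℂ, ‖x‖ ≤ 1 → DifferentiableAt ℂ f x) (hf0 : (f 0).im = 0)
    (hre : ∀ x : ℂ, ‖x‖ = 1 → 0 ≤ (f x).re) :
    ∃ μ : FiniteMeasure Circle, ∀ a : ℂ, ‖a‖ < 1 → herglotzTransform μ a = f a := by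
  have hc : Continuous fun θ : ℝ => f (circleMap 0 1 θ) := by
    refine continuous_iff_continuousAt.mpr fun θ => ?_
    exact ContinuousAt.comp (f := circleMap 0 1) (hf _ (by simp)).continuousAt
      (continuous_circleMap 0 1).continuousAt
  have hcr : Continuous fun θ : ℝ => (f (circleMap 0 1 θ)).re := Complex.continuous_re.comp hc
  have hnn : ∀ θ : ℝ, 0 ≤ (f (circleMap 0 1 θ)).re := fun θ => hre _ (by simp)
  -- The spectrum has density `Re f` with respect to `dθ`, transported to the circle by `θ ↦
  -- e^{iθ}`.
  set ν : Measure ℝ := (volume.restrict (Set.Ioc 0 (2 * Real.pi))).withDensity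
    fun θ => ENNReal.ofReal (f (circleMap 0 1 θ)).re with hν
  have hint : Integrable (fun θ : ℝ => (f (circleMap 0 1 θ)).re)
      (volume.restrict (Set.Ioc 0 (2 * Real.pi))) := hcr.integrableOn_Ioc
  have : IsFiniteMeasure ν := isFiniteMeasure_withDensity_ofReal hint.2
  have hm : Measurable Circle.exp := Circle.exp.continuous.measurable
  obtain ⟨μ, hμ⟩ : ∃ μ : FiniteMeasure Circle, (μ : Measure Circle) = ν.map Circle.exp :=
    ⟨⟨ν.map Circle.exp, inferInstance⟩, rfl⟩
  refine ⟨μ, fun a ha => ?_⟩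
  rw [← circleAverage_herglotzKernel_mul_re hf hf0 ha, herglotzTransform, Real.circleAverage_def,
    hμ,
    integral_map hm.aemeasurable (continuous_herglotzKernel ha).aestronglyMeasurable, hν,
    integral_withDensity_eq_integral_toReal_smul hcr.measurable.ennreal_ofReal (by simp),
    intervalIntegral.integral_of_le Real.two_pi_pos.le]
  have htr := fun θ => ENNReal.toReal_ofReal (hnn θ)
  simp only [circleMap_zero, Complex.ofReal_one, one_mul] at htr
  simp only [htr, Circle.coe_exp, circleMap_zero, Complex.real_smul,
    Complex.ofReal_one, one_mul]
  simp only [mul_comm, one_div, Complex.ofReal_inv, Complex.ofReal_mul, Complex.ofReal_ofNat]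

/-! ### Lower bound for extremal data. -/

/-- The Blaschke product of the nodes other than the first one. -/
noncomputable def tailBlaschkeProduct {n : ℕ} (z : Fin (n + 1) → ℂ) (a : ℂ) : ℂ :=
  ∏ j : Fin n, (a - z j.succ) / (1 - conj (z j.succ) * a)

lemma blaschkeProduct_eq_mul_tail {n : ℕ} {z : Fin (n + 1) → ℂ} (hz0 : z 0 = 0) (a : ℂ) :
    blaschkeProduct z a = a * tailBlaschkeProduct z a := by
  simp [blaschkeProduct, tailBlaschkeProduct, Fin.prod_univ_succ, hz0, mul_div_assoc]

lemma tailBlaschkeProduct_apply_node {n : ℕ} (z : Fin (n + 1) → ℂ) (j : Fin n) :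
    tailBlaschkeProduct z (z j.succ) = 0 :=
  Finset.prod_eq_zero (Finset.mem_univ j) (by simp)

lemma norm_tailBlaschkeProduct_le {n : ℕ} {z : Fin (n + 1) → ℂ} (hz : ∀ k, ‖z k‖ < 1) {a : ℂ}
    (ha : ‖a‖ ≤ 1) : ‖tailBlaschkeProduct z a‖ ≤ 1 := by
  rw [tailBlaschkeProduct, norm_prod]
  refine Finset.prod_le_one (fun _ _ => norm_nonneg _) fun j _ => ?_
  rw [norm_div]
  exact div_le_one_of_le₀ (norm_sub_le_norm_one_sub_conj_mul (hz _).le ha) (norm_nonneg _)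

lemma differentiableAt_tailBlaschkeProduct {n : ℕ} {z : Fin (n + 1) → ℂ} (hz : ∀ k, ‖z k‖ < 1)
    {a : ℂ} (ha : ‖a‖ ≤ 1) : DifferentiableAt ℂ (tailBlaschkeProduct z) a := by
  refine DifferentiableAt.fun_finsetProd fun j _ => ?_
  exact DifferentiableAt.div (by fun_prop) (by fun_prop) (one_sub_conj_mul_ne_zero (hz _) ha)

lemma blaschkeProduct_ne_zero_iff {n : ℕ} {z : Fin (n + 1) → ℂ} (hz : ∀ k, ‖z k‖ < 1) {a : ℂ}
    (ha : ‖a‖ < 1) : blaschkeProduct z a ≠ 0 ↔ ∀ k, a ≠ z k := by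
  simp [blaschkeProduct, Finset.prod_ne_zero_iff, one_sub_conj_mul_ne_zero (hz _) ha.le, sub_eq_zero]

lemma one_sub_norm_sq_pos {a : ℂ} (ha : ‖a‖ < 1) : 0 < 1 - ‖a‖ ^ 2 := by
  nlinarith [norm_nonneg a]

lemma one_sub_conj_mul_self (a : ℂ) : 1 - conj a * a = ((1 - ‖a‖ ^ 2 : ℝ) : ℂ) := by
  rw [Complex.conj_mul']; push_cast; ring

lemma one_add_conj_mul_self (a : ℂ) : 1 + conj a * a = ((1 + ‖a‖ ^ 2 : ℝ) : ℂ) := by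
  rw [Complex.conj_mul']; push_cast; ring

/-- When the data are those of `w₀ (1 + conj α x) / (1 - conj α x)`, the values at `α` of the
Herglotz transforms of consistent spectra fill a disc. -/
theorem exists_mem_uncertaintySet_herglotzTransform_eq {n : ℕ} {z w : Fin (n + 1) → ℂ}
    (hz : ∀ k, ‖z k‖ < 1) (hz0 : z 0 = 0) (hw0 : (w 0).im = 0) (hw0' : 0 ≤ (w 0).re) {α : ℂ}
    (hα : ‖α‖ < 1)
    (hw : ∀ k, k ≠ 0 → w k = w 0 * (1 + z k * conj α) / (1 - z k * conj α)) {t : ℂ} (ht : ‖t‖ < 1) :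
    ∃ μ ∈ uncertaintySet z w, herglotzTransform μ α =
      w 0 * ((1 + ‖α‖ ^ 2 : ℝ) + 2 * blaschkeProduct z α * t) / ((1 - ‖α‖ ^ 2 : ℝ) : ℂ) := by
  -- The quotient `Q / P = x (conj α + s) / (1 + α s)` is a Schur function that reduces to `conj α
  -- x` where `s = 0`, in particular at the nodes `z₁, …, z_n`. Its Cayley transform times `w 0`
  -- interpolates the data for every `t`.
  set s : ℂ → ℂ := fun x => t * tailBlaschkeProduct z x with hs
  set P : ℂ → ℂ := fun x => 1 + α * s x with hPdef
  set Q : ℂ → ℂ := fun x => x * (conj α + s x) with hQdef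
  have hs1 : ∀ x, ‖x‖ ≤ 1 → ‖s x‖ < 1 := fun x hx => by
    rw [hs, norm_mul]
    nlinarith [norm_tailBlaschkeProduct_le hz hx, norm_nonneg t,
      norm_nonneg (tailBlaschkeProduct z x)]
  have hQP : ∀ x, ‖x‖ ≤ 1 → ‖Q x‖ < ‖P x‖ := fun x hx => by
    have h1 := norm_sub_lt_norm_one_sub_conj_mul (a := -conj α) (b := s x) (by simpa using hα)
      (hs1 x hx)
    have h2 : ‖Q x‖ ≤ ‖conj α + s x‖ := by
      simp only [hQdef, norm_mul]
      exact mul_le_of_le_one_left (norm_nonneg _) hx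
    simp only [map_neg, Complex.conj_conj, sub_neg_eq_add, neg_mul] at h1
    rw [add_comm] at h1
    exact h2.trans_lt h1
  have hne : ∀ x, ‖x‖ ≤ 1 → P x - Q x ≠ 0 := fun x hx h => by
    have := hQP x hx
    rw [sub_eq_zero.mp h] at this
    exact lt_irrefl _ this
  have hsd : ∀ x, ‖x‖ ≤ 1 → DifferentiableAt ℂ s x := fun x hx =>
    (differentiableAt_tailBlaschkeProduct hz hx).const_mul t
  have hPd : ∀ x, ‖x‖ ≤ 1 → DifferentiableAt ℂ P x := fun x hx =>
    ((hsd x hx).const_mul α).const_add 1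
  have hQd : ∀ x, ‖x‖ ≤ 1 → DifferentiableAt ℂ Q x := fun x hx =>
    differentiableAt_id.mul ((hsd x hx).const_add _)
  have hwr : w 0 = ((w 0).re : ℂ) := Complex.ext (by simp) (by simp [hw0])
  set f : ℂ → ℂ := fun x => w 0 * ((P x + Q x) / (P x - Q x)) with hf
  have hfd : ∀ x, ‖x‖ ≤ 1 → DifferentiableAt ℂ f x := fun x hx =>
    (((hPd x hx).add (hQd x hx)).div ((hPd x hx).sub (hQd x hx)) (hne x hx)).const_mul (w 0)
  have hf0 : f 0 = w 0 := by
    have h := hne 0 (by simp)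
    have hQ0 : Q 0 = 0 := by simp [hQdef]
    rw [hQ0, sub_zero] at h
    simp [hf, hQ0, div_self h]
  have hre : ∀ x, ‖x‖ = 1 → 0 ≤ (f x).re := fun x hx => by
    have h1 : (f x).re = (w 0).re * ((P x + Q x) / (P x - Q x)).re := by
      simp only [hf]
      rw [hwr, Complex.re_ofReal_mul, Complex.ofReal_re]
    -- The real part of `(P + Q) / (P - Q)` is `(|P|² - |Q|²) / |P - Q|²`.
    have h2 := congrFun (poissonKernel_eq_re_herglotzRieszKernel (c := 0) (w := Q x)) (P x)
    simp only [poissonKernel_def, herglotzRieszKernel_def, Function.comp_apply, sub_zero] at h2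
    rw [h1, ← h2]
    have h3 := hQP x hx.le
    refine mul_nonneg hw0' (div_nonneg ?_ (by positivity))
    nlinarith [norm_nonneg (Q x)]
  obtain ⟨μ, hμ⟩ := exists_herglotzTransform_eq hfd (by rw [hf0, hw0]) hre
  refine ⟨μ, fun k => ?_, ?_⟩
  · rw [hμ _ (hz k)]
    rcases Fin.eq_zero_or_eq_succ k with rfl | ⟨j, rfl⟩
    · rw [hz0, hf0]
    · have hsz : s (z j.succ) = 0 := by simp [hs, tailBlaschkeProduct_apply_node]
      rw [hw _ (Fin.succ_ne_zero j)]
      simp [hf, hPdef, hQdef, hsz, mul_div_assoc]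
  -- At `x = α` the terms `α s` cancel in `P - Q = 1 - |α|²` and double in `P + Q`, so the value is
  -- affine in `t`.
  · rw [hμ α hα, ← one_sub_conj_mul_self, ← one_add_conj_mul_self, blaschkeProduct_eq_mul_tail hz0]
    simp only [hf, hPdef, hQdef, hs]
    rw [mul_div_assoc]
    congr 2 <;> ring

/-- The diameter of the set of consistent spectra is at least the value `4 w₀ |B(α)| / (1 - |α|²)` when the data
are those of `w₀ (1 + conj α x) / (1 - conj α x)`. -/
theorem ofReal_le_diameterK {n : ℕ} {z w : Fin (n + 1) → ℂ}
    (hz : ∀ k, ‖z k‖ < 1) (hz0 : z 0 = 0) (hw0 : (w 0).im = 0) (hw0' : 0 ≤ (w 0).re) {K : Set ℂ}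
    {α : ℂ} (hα : ‖α‖ < 1) (hαK : α ∈ K)
    (hw : ∀ k, k ≠ 0 → w k = w 0 * (1 + z k * conj α) / (1 - z k * conj α)) :
    ENNReal.ofReal (4 * (w 0).re * ‖blaschkeProduct z α‖ / (1 - ‖α‖ ^ 2)) ≤
      diameterK K (uncertaintySet z w) := by
  set M := 4 * (w 0).re * ‖blaschkeProduct z α‖ / (1 - ‖α‖ ^ 2) with hM
  have hα2 := one_sub_norm_sq_pos hα
  have hM0 : 0 ≤ M := by positivity
  have hwr : w 0 = ((w 0).re : ℂ) := Complex.ext (by simp) (by simp [hw0])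
  obtain ⟨u, hu, huB⟩ : ∃ u : ℂ, ‖u‖ ≤ 1 ∧ blaschkeProduct z α * u = ‖blaschkeProduct z α‖ := by
    by_cases hB : blaschkeProduct z α = 0
    · exact ⟨0, by simp, by simp [hB]⟩
    · refine ⟨‖blaschkeProduct z α‖ / blaschkeProduct z α, ?_, by field_simp⟩
      rw [norm_div, Complex.norm_real, norm_norm]
      exact div_self_le_one _
  -- The bound corresponds to `t = ±u`, but the construction needs `|t| < 1`; hence `t = ±r u`,
  -- followed by `r → 1`.
  have key : ∀ r : ℝ, 0 ≤ r → r < 1 →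
      ENNReal.ofReal (r * M) ≤ diameterK K (uncertaintySet z w) := by
    intro r hr0 hr1
    have hru : ‖(r : ℂ) * u‖ < 1 := by
      rw [norm_mul, Complex.norm_real, Real.norm_of_nonneg hr0]
      nlinarith [norm_nonneg u]
    obtain ⟨μ₀, hμ₀, h0⟩ := exists_mem_uncertaintySet_herglotzTransform_eq hz hz0 hw0 hw0' hα hw hru
    obtain ⟨μ₁, hμ₁, h1⟩ := exists_mem_uncertaintySet_herglotzTransform_eq hz hz0 hw0 hw0' hα hw
      (t := -((r : ℂ) * u)) (by rwa [norm_neg])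
    have hd : poissonIntegral μ₀ α - poissonIntegral μ₁ α = r * M := by
      rw [poissonIntegral_eq_re _ hα, poissonIntegral_eq_re _ hα, ← Complex.sub_re, h0, h1]
      have : w 0 * (((1 + ‖α‖ ^ 2 : ℝ) : ℂ) + 2 * blaschkeProduct z α * (r * u)) /
          ((1 - ‖α‖ ^ 2 : ℝ) : ℂ) -
          w 0 * (((1 + ‖α‖ ^ 2 : ℝ) : ℂ) + 2 * blaschkeProduct z α * (-(r * u))) /
          ((1 - ‖α‖ ^ 2 : ℝ) : ℂ) = ((r * M : ℝ) : ℂ) := by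
        rw [hM]
        push_cast
        rw [← huB, ← hwr]
        ring
      rw [this, Complex.ofReal_re]
    refine le_iSup₂_of_le μ₀ hμ₀ (le_iSup₂_of_le μ₁ hμ₁ (le_iSup₂_of_le α hαK ?_))
    rw [hd, abs_of_nonneg (mul_nonneg hr0 hM0)]
  have hlim : Filter.Tendsto (fun r : ℝ => ENNReal.ofReal (r * M)) (nhdsWithin 1 (Set.Iio 1))
      (nhds (ENNReal.ofReal (1 * M))) :=
    (ENNReal.continuous_ofReal.comp (continuous_mul_const M)).continuousWithinAt
  rw [one_mul] at hlim
  refine le_of_tendsto hlim ?_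
  filter_upwards [Ioo_mem_nhdsLT (show (0 : ℝ) < 1 by norm_num)] with r hr
  exact key r hr.1.le hr.2

/-! ### Upper bound through the extremal kernel. -/

section Uncertainty

variable {n : ℕ} {z w : Fin (n + 1) → ℂ}

lemma two_pi_mul_re_eq_mass (hz0 : z 0 = 0) {μ : FiniteMeasure Circle}
    (hμ : μ ∈ uncertaintySet z w) : (μ : Measure Circle).real Set.univ = 2 * Real.pi * (w 0).re := by
  have h := two_pi_mul_herglotzTransform μ (a := 0) (by simp)
  have h0 := hμ 0
  rw [hz0] at h0
  rw [h0, cauchyTransform_zero] at h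
  have h1 : ((μ : Measure Circle).real Set.univ : ℂ) = ((2 * Real.pi : ℝ) : ℂ) * w 0 := by
    push_cast
    linear_combination -h
  have h2 := congrArg Complex.re h1
  rwa [Complex.re_ofReal_mul, Complex.ofReal_re] at h2

lemma cauchyTransform_node (hz : ∀ k, ‖z k‖ < 1) (hz0 : z 0 = 0) (hw0 : (w 0).im = 0)
    {μ : FiniteMeasure Circle} (hμ : μ ∈ uncertaintySet z w) (k : Fin (n + 1)) :
    cauchyTransform μ (z k) = Real.pi * (w k + w 0) := by
  have h := two_pi_mul_herglotzTransform μ (hz k)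
  have hwr : w 0 = ((w 0).re : ℂ) := Complex.ext (by simp) (by simp [hw0])
  rw [hμ k, two_pi_mul_re_eq_mass hz0 hμ] at h
  push_cast at h
  rw [← hwr] at h
  linear_combination -h / 2

lemma re_zero_pos_of_posDef (hz0 : z 0 = 0) (hP : (pickMatrix z w).PosDef) : 0 < (w 0).re := by
  have h := hP.diag_pos (i := 0)
  simp only [pickMatrix, Matrix.of_apply, hz0, zero_mul, sub_zero, div_one, Complex.add_conj] at h
  rw [Complex.zero_lt_real] at h
  linarith

/-- Coinciding nodes would carry the same value of the Herglotz transform, giving the Pick matrix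
two equal rows. -/
lemma injective_of_mem_uncertaintySet (hP : (pickMatrix z w).PosDef) {μ : FiniteMeasure Circle}
    (hμ : μ ∈ uncertaintySet z w) : Function.Injective z := by
  intro k l hkl
  by_contra hne
  refine hP.det_pos.ne' (Matrix.det_zero_of_row_eq hne ?_)
  funext j
  simp [pickMatrix, ← hμ k, ← hμ l, hkl]

open Polynomial in
/-- `(1 - conj a X) ∏ (1 - conj z_j X)`, the numerator of the reciprocal of the Blaschke product
with zeros `a, z₁, …, z_n`. -/
noncomputable def extremalNumerator (z : Fin (n + 1) → ℂ) (a : ℂ) : ℂ[X] :=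
  (1 - C (conj a) * X) * ∏ j : Fin n, (1 - C (conj (z j.succ)) * X)

/-- The reciprocal of the Blaschke product with zeros `a, z₁, …, z_n`. -/
noncomputable def extremalKernel (z : Fin (n + 1) → ℂ) (a : ℂ) (ζ : Circle) : ℂ :=
  (ζ : ℂ) * (extremalNumerator z a).eval (ζ : ℂ) /
    ∏ i : Option (Fin (n + 1)), ((ζ : ℂ) - i.elim a z)

open Polynomial in
lemma eval_extremalNumerator (a x : ℂ) : (extremalNumerator z a).eval x =
    (1 - conj a * x) * ∏ j : Fin n, (1 - conj (z j.succ) * x) := by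
  simp [extremalNumerator, eval_prod]

open Polynomial in
lemma degree_one_sub_C_mul_X_le (a : ℂ) : (1 - C a * X).degree ≤ 1 := by
  compute_degree

open Polynomial in
lemma degree_prod_one_sub_C_mul_X_le {ι : Type*} (s : Finset ι) (v : ι → ℂ) :
    (∏ j ∈ s, (1 - C (v j) * X) : ℂ[X]).degree ≤ (s.card : WithBot ℕ) := by
  have h := (degree_prod_le s fun j => (1 - C (v j) * X : ℂ[X])).trans
    (Finset.sum_le_card_nsmul s _ 1 fun j _ => degree_one_sub_C_mul_X_le (v j))
  rwa [nsmul_one] at h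

open Polynomial in
lemma degree_extremalNumerator_lt (z : Fin (n + 1) → ℂ) (a : ℂ) :
    (extremalNumerator z a).degree < Fintype.card (Option (Fin (n + 1))) := by
  -- There are `n + 1` linear factors against `n + 2` points.
  have h : (extremalNumerator z a).degree ≤ 1 + (n : WithBot ℕ) := by
    refine (degree_mul_le _ _).trans (add_le_add (degree_one_sub_C_mul_X_le _) ?_)
    simpa using degree_prod_one_sub_C_mul_X_le Finset.univ fun j : Fin n => conj (z j.succ)
  refine h.trans_lt ?_
  simp only [Fintype.card_option, Fintype.card_fin]
  norm_cast
  omega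

lemma extremalKernel_eq (a : ℂ) (ζ : Circle) : extremalKernel z a ζ =
    (ζ : ℂ) * (extremalNumerator z a).eval (ζ : ℂ) /
      (((ζ : ℂ) - a) * ∏ k, ((ζ : ℂ) - z k)) := by
  simp [extremalKernel, Fintype.prod_option]

lemma continuous_extremalKernel (hz : ∀ k, ‖z k‖ < 1) {a : ℂ} (ha : ‖a‖ < 1) :
    Continuous (extremalKernel z a) := by
  refine Continuous.div ?_ ?_ fun ζ => Finset.prod_ne_zero_iff.mpr fun i _ => ?_
  · fun_prop
  · fun_prop
  · cases i
    exacts [circle_sub_ne_zero ha ζ, circle_sub_ne_zero (hz _) ζ]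

/-- The node `z 0 = 0` contributes the factor `ζ`, which matches the one in the numerator; the other
factors pair off by `|1 - conj b ζ| = |ζ - b|`. -/
lemma norm_extremalKernel (hz : ∀ k, ‖z k‖ < 1) (hz0 : z 0 = 0) {a : ℂ} (ha : ‖a‖ < 1)
    (ζ : Circle) : ‖extremalKernel z a ζ‖ = 1 := by
  rw [extremalKernel_eq, eval_extremalNumerator, norm_div, norm_mul, norm_mul, norm_mul,
    norm_prod, norm_prod, Fin.prod_univ_succ, hz0, sub_zero]
  simp only [Circle.norm_one_sub_conj_mul, Circle.norm_coe, one_mul]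
  exact div_self (mul_ne_zero (norm_ne_zero_iff.mpr (circle_sub_ne_zero ha ζ))
    (Finset.prod_ne_zero_iff.mpr fun i _ => norm_ne_zero_iff.mpr (circle_sub_ne_zero (hz _) ζ)))

lemma extremalNumerator_eval_self_div (hz0 : z 0 = 0) (a : ℂ) :
    (extremalNumerator z a).eval a / ∏ k, (a - z k) =
      ((1 - ‖a‖ ^ 2 : ℝ) : ℂ) / blaschkeProduct z a := by
  rw [eval_extremalNumerator, one_sub_conj_mul_self, blaschkeProduct, Finset.prod_div_distrib,
    Fin.prod_univ_succ (fun k => 1 - conj (z k) * a), hz0]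
  simp [div_div_eq_mul_div]

/-- In the partial fraction expansion the terms at the nodes depend only on the data and cancel; the
term at `a` survives. -/
lemma integral_extremalKernel_sub (hz : ∀ k, ‖z k‖ < 1) (hz0 : z 0 = 0) (hw0 : (w 0).im = 0)
    (hinj : Function.Injective z) {μ₀ μ₁ : FiniteMeasure Circle} (h₀ : μ₀ ∈ uncertaintySet z w)
    (h₁ : μ₁ ∈ uncertaintySet z w) {a : ℂ} (ha : ‖a‖ < 1) (haz : ∀ k, a ≠ z k) :
    ∫ ζ, extremalKernel z a ζ ∂(μ₀ : Measure Circle) -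
      ∫ ζ, extremalKernel z a ζ ∂(μ₁ : Measure Circle) =
      ((1 - ‖a‖ ^ 2 : ℝ) : ℂ) / blaschkeProduct z a *
        (cauchyTransform μ₀ a - cauchyTransform μ₁ a) := by
  have hv : Function.Injective fun i : Option (Fin (n + 1)) => i.elim a z := by
    rintro (_ | k) (_ | l) h
    · rfl
    · exact absurd h (haz l)
    · exact absurd h.symm (haz k)
    · exact congrArg some (hinj h)
  have hv1 : ∀ i : Option (Fin (n + 1)), ‖i.elim a z‖ < 1 := by
    rintro (_ | k)
    exacts [ha, hz k]
  have he : (Finset.univ : Finset (Option (Fin (n + 1)))).erase none =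
      Finset.univ.map Function.Embedding.some := by
    ext i; cases i <;> simp
  simp only [extremalKernel, integral_partialFraction hv hv1 (degree_extremalNumerator_lt z a)]
  rw [Fintype.sum_option, Fintype.sum_option]
  simp only [Option.elim_some, Option.elim_none, cauchyTransform_node hz hz0 hw0 h₀,
    cauchyTransform_node hz hz0 hw0 h₁]
  rw [he, Finset.prod_map]
  simp only [Function.Embedding.some_apply, Option.elim_some, extremalNumerator_eval_self_div hz0]
  ring

-- Multiplication by `ζ - a` removes the pole at `a`, so only kernels at the nodes remain. The
-- denominator `1 - conj z_j ζ` cancels a factor of the numerator and keeps its degree below the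
-- number `n + 1` of nodes.
open Polynomial in
lemma integral_mul_extremalKernel_eq (hz : ∀ k, ‖z k‖ < 1) (hz0 : z 0 = 0) (hw0 : (w 0).im = 0)
    (hinj : Function.Injective z) {μ₀ μ₁ : FiniteMeasure Circle} (h₀ : μ₀ ∈ uncertaintySet z w)
    (h₁ : μ₁ ∈ uncertaintySet z w) {a : ℂ} (ha : ‖a‖ < 1) (j : Fin n) :
    ∫ ζ : Circle, ((ζ : ℂ) - a) / (1 - conj (z j.succ) * ζ) * extremalKernel z a ζ
        ∂(μ₀ : Measure Circle) =
      ∫ ζ : Circle, ((ζ : ℂ) - a) / (1 - conj (z j.succ) * ζ) * extremalKernel z a ζ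
        ∂(μ₁ : Measure Circle) := by
  set q : ℂ[X] := (1 - C (conj a) * X) *
    ∏ i ∈ Finset.univ.erase j, (1 - C (conj (z i.succ)) * X) with hq
  have hqd : q.degree < Fintype.card (Fin (n + 1)) := by
    have hn : 0 < n := j.pos
    have h : q.degree ≤ 1 + ((n - 1 : ℕ) : WithBot ℕ) := by
      refine (degree_mul_le _ _).trans (add_le_add (degree_one_sub_C_mul_X_le _) ?_)
      simpa using degree_prod_one_sub_C_mul_X_le (Finset.univ.erase j)
        fun i : Fin n => conj (z i.succ)
    refine h.trans_lt ?_
    simp only [Fintype.card_fin]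
    norm_cast
    omega
  have e : ∀ ζ : Circle, ((ζ : ℂ) - a) / (1 - conj (z j.succ) * ζ) * extremalKernel z a ζ =
      (ζ : ℂ) * q.eval (ζ : ℂ) / ∏ k, ((ζ : ℂ) - z k) := by
    intro ζ
    have h1 := circle_sub_ne_zero ha ζ
    have h2 := one_sub_conj_mul_ne_zero (hz j.succ) (Circle.norm_coe ζ).le
    have h2' : 1 - (ζ : ℂ) * conj (z j.succ) ≠ 0 := by rwa [mul_comm]
    have h3 : ∏ k, ((ζ : ℂ) - z k) ≠ 0 :=
      Finset.prod_ne_zero_iff.mpr fun k _ => circle_sub_ne_zero (hz k) ζ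
    rw [extremalKernel_eq, eval_extremalNumerator,
      ← Finset.mul_prod_erase Finset.univ _ (Finset.mem_univ j)]
    simp only [hq, eval_mul, eval_prod, eval_sub, eval_one, eval_C, eval_X]
    field_simp
  simp only [e, integral_partialFraction hinj hz hqd, cauchyTransform_node hz hz0 hw0 h₀,
    cauchyTransform_node hz hz0 hw0 h₁]

lemma pi_mul_poissonIntegral_sub (hz0 : z 0 = 0) {μ₀ μ₁ : FiniteMeasure Circle}
    (h₀ : μ₀ ∈ uncertaintySet z w) (h₁ : μ₁ ∈ uncertaintySet z w) {a : ℂ} (ha : ‖a‖ < 1) :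
    Real.pi * (poissonIntegral μ₀ a - poissonIntegral μ₁ a) =
      (cauchyTransform μ₀ a - cauchyTransform μ₁ a).re := by
  have e0 := two_pi_mul_herglotzTransform μ₀ ha
  have e1 := two_pi_mul_herglotzTransform μ₁ ha
  rw [two_pi_mul_re_eq_mass hz0 h₀] at e0
  rw [two_pi_mul_re_eq_mass hz0 h₁] at e1
  have e : (Real.pi : ℂ) * (herglotzTransform μ₀ a - herglotzTransform μ₁ a) =
      cauchyTransform μ₀ a - cauchyTransform μ₁ a := by linear_combination (e0 - e1) / 2
  rw [poissonIntegral_eq_re _ ha, poissonIntegral_eq_re _ ha, ← e, Complex.re_ofReal_mul,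
    Complex.sub_re]

/-- Two consistent spectra have Poisson integrals at `a` that differ by at most
`4 w₀ |B(a)| / (1 - |a|²)`. -/
theorem abs_poissonIntegral_sub_le (hz : ∀ k, ‖z k‖ < 1) (hz0 : z 0 = 0) (hw0 : (w 0).im = 0)
    (hP : (pickMatrix z w).PosDef) {μ₀ μ₁ : FiniteMeasure Circle} (h₀ : μ₀ ∈ uncertaintySet z w)
    (h₁ : μ₁ ∈ uncertaintySet z w) {a : ℂ} (ha : ‖a‖ < 1) :
    |poissonIntegral μ₀ a - poissonIntegral μ₁ a| ≤
      4 * (w 0).re * ‖blaschkeProduct z a‖ / (1 - ‖a‖ ^ 2) := by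
  have ha2 := one_sub_norm_sq_pos ha
  have hw := re_zero_pos_of_posDef hz0 hP
  by_cases haz : ∀ k, a ≠ z k
  · have hB := (blaschkeProduct_ne_zero_iff hz ha).mpr haz
    have hB' := norm_pos_iff.mpr hB
    have h := integral_extremalKernel_sub hz hz0 hw0 (injective_of_mem_uncertaintySet hP h₀)
      h₀ h₁ ha haz
    have hb : ∀ μ ∈ uncertaintySet z w, ‖∫ ζ, extremalKernel z a ζ ∂(μ : Measure Circle)‖ ≤
        2 * Real.pi * (w 0).re := fun μ hμ => by
      refine (norm_integral_le_of_norm_le_const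
        (ae_of_all _ fun ζ => (norm_extremalKernel hz hz0 ha ζ).le)).trans_eq ?_
      rw [one_mul, two_pi_mul_re_eq_mass hz0 hμ]
    have h2 := (norm_sub_le _ _).trans (add_le_add (hb _ h₀) (hb _ h₁))
    rw [h, norm_mul, norm_div, Complex.norm_real, Real.norm_of_nonneg ha2.le] at h2
    have h3 := Complex.abs_re_le_norm (cauchyTransform μ₀ a - cauchyTransform μ₁ a)
    rw [← pi_mul_poissonIntegral_sub hz0 h₀ h₁ ha, abs_mul, abs_of_pos Real.pi_pos] at h3
    rw [le_div_iff₀ ha2]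
    rw [div_mul_eq_mul_div, div_le_iff₀ hB'] at h2
    have h4 := mul_le_mul_of_nonneg_left h3 ha2.le
    refine le_of_mul_le_mul_left ?_ Real.pi_pos
    linarith
  · push Not at haz
    obtain ⟨k, rfl⟩ := haz
    rw [poissonIntegral_eq_re _ ha, poissonIntegral_eq_re _ ha, h₀ k, h₁ k, sub_self, abs_zero]
    positivity

/-- The relation between the data at a node `x` and the integral of the test function
`(ζ - a) / (1 - conj x ζ)`. -/
lemma mul_conj_integral_eq (hz : ∀ k, ‖z k‖ < 1) (hz0 : z 0 = 0) (hw0 : (w 0).im = 0)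
    {μ : FiniteMeasure Circle} (hμ : μ ∈ uncertaintySet z w) (a : ℂ) (k : Fin (n + 1)) :
    z k * conj (∫ ζ : Circle, ((ζ : ℂ) - a) / (1 - conj (z k) * ζ) ∂(μ : Measure Circle)) =
      Real.pi * (w k * (1 - z k * conj a) - w 0 * (1 + z k * conj a)) := by
  rw [← integral_conj, ← integral_const_mul]
  have e : ∀ ζ : Circle, z k * conj (((ζ : ℂ) - a) / (1 - conj (z k) * ζ)) =
      (1 - z k * conj a) * ((ζ : ℂ) / ((ζ : ℂ) - z k)) - 1 := by
    intro ζ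
    have h1 := circle_sub_ne_zero (hz k) ζ
    have h2 := (map_ne_zero (starRingEnd ℂ)).mpr
      (one_sub_conj_mul_ne_zero (hz k) (Circle.norm_coe ζ).le)
    have h3 := Circle.mul_conj_coe ζ
    simp only [map_div₀, map_sub, map_mul, map_one, Complex.conj_conj] at h2 ⊢
    field_simp
    linear_combination (-(z k) ^ 2 * conj a + z k) * h3
  simp only [e]
  rw [integral_sub ((Circle.integrable_of_continuous μ (continuous_cauchyKernel (hz k))).const_mul _)
    (integrable_const _), integral_const_mul]
  have hc := cauchyTransform_node hz hz0 hw0 hμ k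
  have hwr : w 0 = ((w 0).re : ℂ) := Complex.ext (by simp) (by simp [hw0])
  rw [cauchyTransform] at hc
  rw [hc, integral_const, two_pi_mul_re_eq_mass hz0 hμ, Complex.real_smul]
  push_cast
  rw [← hwr]
  ring

end Uncertainty

/-! ### Nearly extremal pairs and rigidity of the data. -/

section Extremal

variable {n : ℕ} {z w : Fin (n + 1) → ℂ}

/-- Stability of the extremal data: if two consistent spectra nearly attain the bound at `a`, then
the data nearly are those of `w₀ (1 + conj a x) / (1 - conj a x)`. -/
theorem norm_defect_le (hz : ∀ k, ‖z k‖ < 1) (hz0 : z 0 = 0) (hw0 : (w 0).im = 0)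
    (hP : (pickMatrix z w).PosDef) {μ₀ μ₁ : FiniteMeasure Circle} (h₀ : μ₀ ∈ uncertaintySet z w)
    (h₁ : μ₁ ∈ uncertaintySet z w) {a : ℂ} (ha : ‖a‖ < 1) (haz : ∀ k, a ≠ z k) {ε : ℝ} (hε : 0 < ε)
    (j : Fin n) :
    ‖w j.succ * (1 - z j.succ * conj a) - w 0 * (1 + z j.succ * conj a)‖ ≤
      2 / (1 - ‖z j.succ‖) * (2 * ε * (w 0).re + (2 * (w 0).re -
        (1 - ‖a‖ ^ 2) / ‖blaschkeProduct z a‖ * (poissonIntegral μ₀ a - poissonIntegral μ₁ a) / 2) /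
          (2 * ε)) := by
  have ha2 := one_sub_norm_sq_pos ha
  have hB := (blaschkeProduct_ne_zero_iff hz ha).mpr haz
  have hB' := norm_pos_iff.mpr hB
  have hinj := injective_of_mem_uncertaintySet hP h₀
  set x := z j.succ with hx
  have hx1 : ‖x‖ < 1 := hz _
  -- This rotation makes the coefficient of the Cauchy kernel at `a` positive, so that the real part
  -- of the change in `∫ T` is a multiple of the Poisson difference.
  set l : ℂ := blaschkeProduct z a / ‖blaschkeProduct z a‖ with hl
  have hl1 : ‖l‖ = 1 := by
    rw [hl, norm_div, Complex.norm_real, norm_norm, div_self hB'.ne']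
  set T : Circle → ℂ := fun ζ => l * extremalKernel z a ζ with hT
  set χ : Circle → ℂ := fun ζ => ((ζ : ℂ) - a) / (1 - conj x * ζ) with hχ
  have hTc : Continuous T := continuous_const.mul (continuous_extremalKernel hz ha)
  have hχc : Continuous χ := Continuous.div (by fun_prop) (by fun_prop) fun ζ =>
    one_sub_conj_mul_ne_zero hx1 (Circle.norm_coe ζ).le
  have hT1 : ∀ ζ, ‖T ζ‖ = 1 := fun ζ => by
    simp only [hT, norm_mul, hl1, norm_extremalKernel hz hz0 ha ζ, one_mul]
  have hT2 : ∀ ζ, ‖-T ζ‖ = 1 := fun ζ => by rw [norm_neg, hT1]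
  have hχ1 : ∀ ζ, ‖χ ζ‖ ≤ 2 / (1 - ‖x‖) := fun ζ => by
    simp only [hχ]
    rw [norm_div, Circle.norm_one_sub_conj_mul]
    refine div_le_div₀ (by norm_num) ?_ (by linarith) ?_
    · have := norm_sub_le (ζ : ℂ) a
      rw [Circle.norm_coe] at this
      linarith
    · have := norm_sub_norm_le (ζ : ℂ) x
      rwa [Circle.norm_coe] at this
  have b0 := norm_integral_mul_one_sub_le μ₀ hTc hT1 hχ1 hε
  -- Near equality pushes `∫ T` to opposite ends for the two spectra, so for `μ₁` it is `-T` that is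
  -- close to `1`.
  have b1 := norm_integral_mul_one_sub_le μ₁ (T := fun ζ => -T ζ) hTc.neg hT2 hχ1 hε
  have hann : ∫ ζ, χ ζ * T ζ ∂(μ₀ : Measure Circle) = ∫ ζ, χ ζ * T ζ ∂(μ₁ : Measure Circle) := by
    have e : ∀ ζ, χ ζ * T ζ = l * (χ ζ * extremalKernel z a ζ) := fun ζ => by
      simp only [hT]; ring
    simp only [e, integral_const_mul]
    rw [integral_mul_extremalKernel_eq hz hz0 hw0 hinj h₀ h₁ ha j]
  have hχT : ∀ μ : FiniteMeasure Circle, Integrable (fun ζ => χ ζ * T ζ) (μ : Measure Circle) :=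
    fun μ => Circle.integrable_of_continuous μ (hχc.mul hTc)
  have hsum : ∫ ζ, χ ζ * (1 - T ζ) ∂(μ₀ : Measure Circle) +
      ∫ ζ, χ ζ * (1 - -T ζ) ∂(μ₁ : Measure Circle) =
      ∫ ζ, χ ζ ∂(μ₀ : Measure Circle) + ∫ ζ, χ ζ ∂(μ₁ : Measure Circle) := by
    simp only [sub_neg_eq_add, mul_sub, mul_add, mul_one]
    rw [integral_sub (Circle.integrable_of_continuous μ₀ hχc) (hχT μ₀),
      integral_add (Circle.integrable_of_continuous μ₁ hχc) (hχT μ₁), hann]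
    ring
  have hTint : (∫ ζ, T ζ ∂(μ₀ : Measure Circle)).re - (∫ ζ, T ζ ∂(μ₁ : Measure Circle)).re =
      (1 - ‖a‖ ^ 2) / ‖blaschkeProduct z a‖ *
        (Real.pi * (poissonIntegral μ₀ a - poissonIntegral μ₁ a)) := by
    have h := integral_extremalKernel_sub hz hz0 hw0 hinj h₀ h₁ ha haz
    have e : ∫ ζ, T ζ ∂(μ₀ : Measure Circle) - ∫ ζ, T ζ ∂(μ₁ : Measure Circle) =
        (((1 - ‖a‖ ^ 2) / ‖blaschkeProduct z a‖ : ℝ) : ℂ) *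
          (cauchyTransform μ₀ a - cauchyTransform μ₁ a) := by
      simp only [hT, integral_const_mul]
      rw [← mul_sub, h, hl]
      push_cast
      field_simp
    rw [← Complex.sub_re, e, Complex.re_ofReal_mul, pi_mul_poissonIntegral_sub hz0 h₀ h₁ ha]
  have m0 := mul_conj_integral_eq hz hz0 hw0 h₀ a j.succ
  have m1 := mul_conj_integral_eq hz hz0 hw0 h₁ a j.succ
  set E := w j.succ * (1 - x * conj a) - w 0 * (1 + x * conj a) with hE
  have hm : x * conj (∫ ζ, χ ζ ∂(μ₀ : Measure Circle) + ∫ ζ, χ ζ ∂(μ₁ : Measure Circle)) =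
      ((2 * Real.pi : ℝ) : ℂ) * E := by
    rw [map_add, mul_add, m0, m1]
    push_cast
    ring
  have hnorm : 2 * Real.pi * ‖E‖ ≤
      ‖∫ ζ, χ ζ ∂(μ₀ : Measure Circle) + ∫ ζ, χ ζ ∂(μ₁ : Measure Circle)‖ := by
    have h := congrArg norm hm
    rw [norm_mul, norm_mul, RCLike.norm_conj, Complex.norm_real,
      Real.norm_of_nonneg Real.two_pi_pos.le] at h
    rw [← h]
    exact mul_le_of_le_one_left (norm_nonneg _) hx1.le
  have htot := (norm_add_le _ _).trans (add_le_add b0 b1)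
  rw [hsum, integral_neg, Complex.neg_re, two_pi_mul_re_eq_mass hz0 h₀,
    two_pi_mul_re_eq_mass hz0 h₁] at htot
  have hfin := hnorm.trans htot
  refine le_of_mul_le_mul_left (hfin.trans_eq ?_) Real.two_pi_pos
  have hI : (∫ ζ, T ζ ∂(μ₁ : Measure Circle)).re = (∫ ζ, T ζ ∂(μ₀ : Measure Circle)).re -
      (1 - ‖a‖ ^ 2) / ‖blaschkeProduct z a‖ *
        (Real.pi * (poissonIntegral μ₀ a - poissonIntegral μ₁ a)) := by linarith
  rw [hI]
  ring

lemma exists_near_extremal {K : Set ℂ} {F : Set (FiniteMeasure Circle)} {M : ℝ}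
    (h : ENNReal.ofReal M ≤ diameterK K F) {r : ℝ} (hr0 : 0 ≤ r) (hr : r < M) :
    ∃ μ₀ ∈ F, ∃ μ₁ ∈ F, ∃ a ∈ K, r < poissonIntegral μ₀ a - poissonIntegral μ₁ a := by
  have h1 : ENNReal.ofReal r < diameterK K F :=
    ((ENNReal.ofReal_lt_ofReal_iff (hr0.trans_lt hr)).mpr hr).trans_le h
  simp only [diameterK, deltaK, lt_iSup_iff] at h1
  obtain ⟨μ₀, h₀, μ₁, h₁, a, ha, hlt⟩ := h1
  have h2 := (ENNReal.ofReal_lt_ofReal_iff_of_nonneg hr0).mp hlt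
  rcases lt_abs.mp h2 with h3 | h3
  · exact ⟨μ₀, h₀, μ₁, h₁, a, ha, h3⟩
  · exact ⟨μ₁, h₁, μ₀, h₀, a, ha, by linarith⟩

lemma continuousOn_norm_blaschkeProduct (hz : ∀ k, ‖z k‖ < 1) {K : Set ℂ}
    (hK : ∀ a ∈ K, ‖a‖ < 1) : ContinuousOn (fun a => ‖blaschkeProduct z a‖) K := by
  refine ContinuousOn.norm (continuousOn_finsetProd _ fun k _ => ?_)
  exact ContinuousOn.div (by fun_prop) (by fun_prop) fun a ha =>
    one_sub_conj_mul_ne_zero (hz k) (hK a ha).le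

/-- If the diameter is at least the positive upper bound `M`, then the data are extremal. -/
theorem exists_extremal_of_le_diameterK (hz : ∀ k, ‖z k‖ < 1) (hz0 : z 0 = 0)
    (hw0 : (w 0).im = 0) (hP : (pickMatrix z w).PosDef) {K : Set ℂ} (hKc : IsCompact K)
    (hKdisc : ∀ a ∈ K, ‖a‖ < 1) (hKne : K.Nonempty) {M : ℝ} (hM0 : 0 < M)
    (hM : ∀ a ∈ K, 4 * (w 0).re * ‖blaschkeProduct z a‖ / (1 - ‖a‖ ^ 2) ≤ M)
    (hd : ENNReal.ofReal M ≤ diameterK K (uncertaintySet z w)) :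
    ∃ α ∈ K, 4 * (w 0).re * ‖blaschkeProduct z α‖ / (1 - ‖α‖ ^ 2) = M ∧
      ∀ j : Fin n, w j.succ * (1 - z j.succ * conj α) - w 0 * (1 + z j.succ * conj α) = 0 := by
  have hw := re_zero_pos_of_posDef hz0 hP
  set m : ℂ → ℝ := fun a => 4 * (w 0).re * ‖blaschkeProduct z a‖ / (1 - ‖a‖ ^ 2) with hm
  set E : Fin n → ℂ → ℂ := fun j a =>
    w j.succ * (1 - z j.succ * conj a) - w 0 * (1 + z j.succ * conj a) with hE
  -- Both summands are non-negative on `K`, so a zero of `Φ` is a point where `m` equals `M` and all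
  -- the data equations hold. The minimum of `Φ` is shown to be at most `0`.
  set Φ : ℂ → ℝ := fun a => (M - m a) + ∑ j, ‖E j a‖ with hΦ
  have hmc : ContinuousOn m K :=
    (continuousOn_const.mul (continuousOn_norm_blaschkeProduct hz hKdisc)).div (by fun_prop)
      fun a ha => (one_sub_norm_sq_pos (hKdisc a ha)).ne'
  have hEc : ∀ j, Continuous (E j) := fun j => by fun_prop
  have hΦc : ContinuousOn Φ K :=
    (continuousOn_const.sub hmc).add
      (continuous_finsetSum _ fun j _ => (hEc j).norm).continuousOn
  obtain ⟨α, hα, hmin⟩ := hKc.exists_isMinOn hKne hΦc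
  set S : ℝ := ∑ j : Fin n, 2 / (1 - ‖z j.succ‖) * (2 * (w 0).re + 2 * (w 0).re / M) with hS
  have key : ∀ ε : ℝ, 0 < ε → ε ^ 2 < M / 2 → Φ α ≤ ε ^ 2 + ε * S := by
    intro ε hε hεM
    -- A gap of `ε²` becomes of order `ε` after the division by `2 ε` in `norm_defect_le`. The
    -- condition `ε² < M / 2` gives `m a > M / 2`, which keeps `a` off the nodes and the constants
    -- independent of `a`.
    obtain ⟨μ₀, h₀, μ₁, h₁, a, ha, hlt⟩ := exists_near_extremal hd (r := M - ε ^ 2)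
      (by linarith) (by linarith [pow_pos hε 2])
    have ha1 := hKdisc a ha
    have ha2 := one_sub_norm_sq_pos ha1
    have hle : poissonIntegral μ₀ a - poissonIntegral μ₁ a ≤ m a :=
      (le_abs_self _).trans (abs_poissonIntegral_sub_le hz hz0 hw0 hP h₀ h₁ ha1)
    have hma : M / 2 < m a := by linarith
    have hma0 : 0 < m a := by linarith
    have hB : blaschkeProduct z a ≠ 0 := fun h => by simp [hm, h] at hma0
    have hB' := norm_pos_iff.mpr hB
    have haz := (blaschkeProduct_ne_zero_iff hz ha1).mp hB
    refine (hmin ha).trans (add_le_add (by linarith [hM a ha]) ?_)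
    rw [hS, Finset.mul_sum]
    refine Finset.sum_le_sum fun j _ => ?_
    refine (norm_defect_le hz hz0 hw0 hP h₀ h₁ ha1 haz hε j).trans ?_
    rw [mul_left_comm]
    refine mul_le_mul_of_nonneg_left ?_ (div_nonneg (by norm_num) (by linarith [hz j.succ]))
    set D := poissonIntegral μ₀ a - poissonIntegral μ₁ a with hD
    have hq : (1 - ‖a‖ ^ 2) / ‖blaschkeProduct z a‖ = 4 * (w 0).re / m a := by
      simp only [hm]
      field_simp
    have h5 : 2 * (w 0).re - (1 - ‖a‖ ^ 2) / ‖blaschkeProduct z a‖ * D / 2 =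
        2 * (w 0).re * (m a - D) / m a := by
      rw [hq]
      field_simp
      ring
    have h6 : 2 * (w 0).re * (m a - D) / m a ≤ 2 * (w 0).re * ε ^ 2 / (M / 2) :=
      div_le_div₀ (by positivity)
        (mul_le_mul_of_nonneg_left (by linarith [hM a ha]) (by positivity)) (by positivity) hma.le
    have h7 : (2 * (w 0).re * ε ^ 2 / (M / 2)) / (2 * ε) = ε * (2 * (w 0).re / M) := by
      field_simp
    rw [h5, mul_add, ← h7]
    refine add_le_add (by linarith) ?_
    exact div_le_div_of_nonneg_right h6 (by positivity)
  have hlim : Filter.Tendsto (fun ε : ℝ => ε ^ 2 + ε * S) (nhdsWithin 0 (Set.Ioi 0)) (nhds 0) := by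
    have hc : Continuous fun ε : ℝ => ε ^ 2 + ε * S := by fun_prop
    simpa using (hc.tendsto 0).mono_left nhdsWithin_le_nhds
  have hΦ0 : Φ α ≤ 0 := by
    refine ge_of_tendsto hlim ?_
    have hc : ∀ᶠ ε : ℝ in nhds 0, ε ^ 2 < M / 2 :=
      (continuous_pow 2).continuousAt.eventually_lt continuousAt_const (by simpa using hM0)
    filter_upwards [self_mem_nhdsWithin, nhdsWithin_le_nhds hc] with ε h1 h2
    exact key ε h1 h2
  have hs : 0 ≤ ∑ j, ‖E j α‖ := Finset.sum_nonneg fun j _ => norm_nonneg _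
  have hMα := hM α hα
  have hΦ0' : (M - m α) + ∑ j, ‖E j α‖ ≤ 0 := hΦ0
  refine ⟨α, hα, le_antisymm hMα (by linarith), fun j => ?_⟩
  have hs0 : ∑ j, ‖E j α‖ = 0 := le_antisymm (by linarith) hs
  exact norm_eq_zero.mp
    ((Finset.sum_eq_zero_iff_of_nonneg fun j _ => norm_nonneg _).mp hs0 j (Finset.mem_univ j))

end Extremal

/-! ### The theorem. -/

theorem theorem18 (n : ℕ) (z w : Fin (n + 1) → ℂ)
    (hz : ∀ k, ‖z k‖ < 1) (hz0 : z 0 = 0)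
    (hw0 : (w 0).im = 0) (hP : (pickMatrix z w).PosDef)
    (K : Set ℂ) (hKclosed : IsClosed K) (hKdisc : ∀ a ∈ K, ‖a‖ < 1) (hKne : K.Nonempty) :
    ∃ M : ℝ,
      IsGreatest ((fun a : ℂ => 4 * (w 0).re * ‖blaschkeProduct z a‖ / (1 - ‖a‖ ^ 2)) '' K) M ∧
      diameterK K (uncertaintySet z w) ≤ ENNReal.ofReal M ∧
      ((∃ a ∈ K, ∀ k, a ≠ z k) →
        (diameterK K (uncertaintySet z w) = ENNReal.ofReal M ↔
          ∃ α ∈ K, IsMaxOn (fun a : ℂ => ‖blaschkeProduct z a‖ / (1 - ‖a‖ ^ 2)) K α ∧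
            ∀ k, k ≠ 0 → w k = w 0 * (1 + z k * conj α) / (1 - z k * conj α))) := by
  have hw := re_zero_pos_of_posDef hz0 hP
  have hKc : IsCompact K := (isCompact_closedBall (0 : ℂ) 1).of_isClosed_subset hKclosed
    fun a ha => by simpa using (hKdisc a ha).le
  have hmc : ContinuousOn (fun a : ℂ => 4 * (w 0).re * ‖blaschkeProduct z a‖ / (1 - ‖a‖ ^ 2)) K :=
    (continuousOn_const.mul (continuousOn_norm_blaschkeProduct hz hKdisc)).div (by fun_prop)
      fun a ha => (one_sub_norm_sq_pos (hKdisc a ha)).ne'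
  obtain ⟨M, hM⟩ := (hKc.image_of_continuousOn hmc).exists_isGreatest (hKne.image _)
  have hMle : ∀ a ∈ K, 4 * (w 0).re * ‖blaschkeProduct z a‖ / (1 - ‖a‖ ^ 2) ≤ M :=
    fun a ha => hM.2 (Set.mem_image_of_mem _ ha)
  have hdiam : diameterK K (uncertaintySet z w) ≤ ENNReal.ofReal M :=
    iSup₂_le fun μ₀ h₀ => iSup₂_le fun μ₁ h₁ => iSup₂_le fun a ha =>
      ENNReal.ofReal_le_ofReal
        ((abs_poissonIntegral_sub_le hz hz0 hw0 hP h₀ h₁ (hKdisc a ha)).trans (hMle a ha))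
  refine ⟨M, hM, hdiam, fun ⟨b, hb, hbz⟩ => ⟨fun heq => ?_, ?_⟩⟩
  -- The point `b` off the nodes makes the bound positive; if `K` lay inside the nodes, `M` would be
  -- `0` and equality would say nothing about the data.
  · have hM0 : 0 < M := by
      refine lt_of_lt_of_le ?_ (hMle b hb)
      have hB := norm_pos_iff.mpr ((blaschkeProduct_ne_zero_iff hz (hKdisc b hb)).mpr hbz)
      have hb2 := one_sub_norm_sq_pos (hKdisc b hb)
      positivity
    obtain ⟨α, hα, hαM, hdata⟩ := exists_extremal_of_le_diameterK hz hz0 hw0 hP hKc hKdisc hKne hM0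
      hMle heq.ge
    refine ⟨α, hα, fun a ha => ?_, fun k hk => ?_⟩
    · have h := (hMle a ha).trans_eq hαM.symm
      rw [mul_div_assoc, mul_div_assoc] at h
      exact le_of_mul_le_mul_left h (by positivity)
    · obtain ⟨j, rfl⟩ := Fin.exists_succ_eq.mpr hk
      have hne : 1 - z j.succ * conj α ≠ 0 := by
        rw [mul_comm]
        exact one_sub_conj_mul_ne_zero (hKdisc α hα) (hz _).le
      rw [eq_div_iff hne]
      exact sub_eq_zero.mp (hdata j)
  · rintro ⟨α, hα, hmax, hdata⟩
    refine le_antisymm hdiam ?_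
    have hMα : M ≤ 4 * (w 0).re * ‖blaschkeProduct z α‖ / (1 - ‖α‖ ^ 2) := by
      obtain ⟨a, ha, rfl⟩ := hM.1
      simp only [mul_div_assoc]
      exact mul_le_mul_of_nonneg_left (hmax ha) (by positivity)
    exact (ENNReal.ofReal_le_ofReal hMα).trans
      (ofReal_le_diameterK hz hz0 hw0 hw.le (hKdisc α hα) hα hdata)
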